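/- **Conventions.** Let $E$ be a real Hausdorff locally convex space. A map $f : U \to E'$ from an open subset $U \subseteq E$ to another such space is *smooth* if all iterated directional derivatives $d^jf(x)(h_1,\dots,h_j) = (\partial_{h_j}\cdots\partial_{h_1}f)(x)$ exist for $j\ge 0$, $x \in U$, $h_i \in E$, and all maps $d^jf : U\times E^j \to E'$ are continuous. Let $M$ be a smooth manifold modeled on $E$ (with charts in $E$ and smooth chart changes). A *weak Poisson structure* on $M$ is a unital subalgebra $\mathcal A \subseteq C^\infty(M,\mathbb R)$ with a bracket $\{\cdot,\cdot\}:\mathcal A\times\mathcal A\to\mathcal A$ such that * (P1) $\{\cdot,\cdot\}$ is a Lie bracket (bilinear, skew-symmetric, and satisfying the Jacobi identity), and $\{F,GH\}=\{F,G\}H+G\{F,H\}$ for all $F,G,H \in \mathcal A$; * (P2) if $m\in M$ and $v\in T_m(M)$ satisfy $dF(m)v=0$ for all $F\in\mathcal A$, then $v=0$; * (P3) for every $H\in\mathcal A$ there is a smooth vector field $X_H$ on $M$ with $X_HF=\{F,H\}$ for all $F\in\mathcal A$ (by (P2) it is unique; it is called the *Hamiltonian vector field* of $H$). Then $(M,\mathcal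 A,\{\cdot,\cdot\})$ is called a *weak Poisson manifold*. A *Poisson map* $\varphi : (M_1,\mathcal A_1,\{\cdot,\cdot\}_1)\to (M_2,\mathcal A_2,\{\cdot,\cdot\}_2)$ is a smooth map with $\varphi^*\mathcal A_2\subseteq \mathcal A_1$ and $\varphi^*\{F,G\}_2=\{\varphi^*F,\varphi^*G\}_1$ for all $F,G\in\mathcal A_2$. A subset $N\subseteq M$ is a *submanifold* if there is a closed subspace $S\subseteq E$ such that around every point of $N$ there is an $E$-chart $(\varphi,U)$ of $M$ (smoothly compatible with the atlas of $M$) with $\varphi(U\cap N)=\varphi(U)\cap S$. The restrictions $\varphi|_{U\cap N}$ of these charts are the charts of $N$, with values in $S$. **Proposition (Poisson submanifolds).** Let $(M,\mathcal A,\{\cdot,\cdot\})$ be a weak Poisson manifold and let $N\subseteq M$ be a submanifold such that, for every $F\in\mathcal A$, the restriction of $X_F$ to $N$ is tangential to $N$, i.e. $X_F(n)\in T_n(N)$ for all $n\in N$. Then the ideal $\mathcal I_N:=\{F\in\mathcal A : F|_N=0\}$ is an ideal with respect to the Poisson bracket, i.e. $\{\mathcal I_N,\mathcal A\}\subseteq\mathcal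 I_N$. Moreover, $N$ with the charts described above is a smooth manifold modeled on $S$, and the quotient $\mathcal A_N:=\mathcal A/\mathcal I_N$, identified through $F+\mathcal I_N\mapsto F|_N$ with a unital subalgebra of $C^\infty(N,\mathbb R)$, with the induced bracket $\{F|_N,G|_N\}:=\{F,G\}|_N$, is a weak Poisson structure on $N$ for which the inclusion $N\to M$ is a Poisson map. -/

import Mathlib

open scoped Topology
open Filter

/-! Poisson structures on manifolds modeled on (real, Hausdorff) locally convex spaces. -/

namespace LC

noncomputable section

universe u v w

/-! ### Differential calculus in locally convex spaces -/

section Calculus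

variable {E : Type u} [AddCommGroup E] [Module ℝ E] [TopologicalSpace E]
  {F : Type v} [AddCommGroup F] [Module ℝ F] [TopologicalSpace F]

/-- `f` has derivative `v` at `x` in the direction `h`, i.e. `(f (x + t h) - f x) / t → v`
as `t → 0`, `t ≠ 0`. -/
def HasDirDeriv (f : E → F) (x h : E) (v : F) : Prop :=
  Tendsto (fun t : ℝ => t⁻¹ • (f (x + t • h) - f x)) (𝓝[≠] 0) (𝓝 v)

/-- The value `df(x)(h)` of the derivative of `f` at `x` in the direction `h`
(meaningful when the limit exists). -/
def dirDeriv (f : E → F) (x h : E) : F :=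
  limUnder (𝓝[≠] 0) (fun t : ℝ => t⁻¹ • (f (x + t • h) - f x))

/-- The iterated directional derivative `(∂_{h_j} ⋯ ∂_{h_1} f)(x)`. -/
def iterDirDeriv (f : E → F) : (j : ℕ) → (Fin j → E) → E → F
  | 0, _ => f
  | j + 1, h => fun x => dirDeriv (iterDirDeriv f j (Fin.init h)) x (h (Fin.last j))

/-- `f` is a `C^∞`-map on the open set `U`: all iterated directional derivatives exist at all
points of `U`, and all the maps `(x, h₁, …, h_j) ↦ (∂_{h_j} ⋯ ∂_{h_1} f)(x)` are continuous on
`U × E^j` (for `j = 0` this says that `f` is continuous on `U`). -/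
def SmoothOn (f : E → F) (U : Set E) : Prop :=
  ∀ j : ℕ,
    (∀ (h : Fin j → E), ∀ x ∈ U, ∀ k : E, ∃ v : F, HasDirDeriv (iterDirDeriv f j h) x k v) ∧
    ContinuousOn (fun p : E × (Fin j → E) => iterDirDeriv f j p.2 p.1) (U ×ˢ Set.univ)

end Calculus

/-! ### Locally convex manifolds -/

section Manifold

variable (E : Type u) [AddCommGroup E] [Module ℝ E] [TopologicalSpace E]
  (M : Type w) [TopologicalSpace M] [ChartedSpace E M]

/-- All chart changes of the atlas of `M` are smooth. -/
class IsSmoothManifold : Prop where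
  smooth_chart_change : ∀ e ∈ atlas E M, ∀ e' ∈ atlas E M,
    SmoothOn (fun y => e' (e.symm y)) (e.symm.trans e').source

variable {M}

/-- An `E`-chart of `M`: a homeomorphism from an open subset of `M` onto an open subset of `E`
which is smoothly compatible with all charts of the given atlas. -/
def IsChart (φ : OpenPartialHomeomorph M E) : Prop :=
  ∀ e ∈ atlas E M,
    SmoothOn (fun y => φ (e.symm y)) (e.symm.trans φ).source ∧
    SmoothOn (fun y => e (φ.symm y)) (φ.symm.trans e).source

/-- The tangent space `T_p(M)`; as usual in Mathlib, it is the model space `E`, a tangent vector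
being represented by its coordinates in the preferred chart `chartAt E p`. -/
abbrev TSpace (_p : M) : Type u := E

variable (E' : Type v) [AddCommGroup E'] [Module ℝ E'] [TopologicalSpace E']
  {M' : Type*} [TopologicalSpace M'] [ChartedSpace E' M']

/-- Smooth maps between locally convex manifolds: continuous, and smooth in all charts. -/
def IsSmooth (f : M → M') : Prop :=
  Continuous f ∧ ∀ e ∈ atlas E M, ∀ e' ∈ atlas E' M',
    SmoothOn (fun y => e' (f (e.symm y))) (e.target ∩ e.symm ⁻¹' (f ⁻¹' e'.source))

/-- The tangent map `T_p(f) : T_p(M) → T_{f p}(M')`, expressed in the preferred charts at `p` and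
`f p`. A vector space such as `ℝ` is a manifold with the identity as its only chart, so for
`F : M → ℝ` the number `tangentMap E ℝ F p v` is `dF(p)v`. -/
def tangentMap (f : M → M') (p : M) (v : TSpace E p) : TSpace E' (f p) :=
  dirDeriv (fun y => chartAt E' (f p) (f ((chartAt E p).symm y))) (chartAt E p p) v

variable (M)

/-- Smooth vector fields: sections of the tangent bundle whose representation `y ↦ de(X(e⁻¹ y))`
in every chart `e` of `M` is smooth. -/
structure VectorField where
  toFun : (p : M) → TSpace E p
  smooth : ∀ e ∈ atlas E M,
    SmoothOn (fun y : E => (tangentMap E E (fun p => e p) (e.symm y) (toFun (e.symm y)) : E))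
      e.target

variable {M E}

instance : CoeFun (VectorField E M) (fun _ => (p : M) → TSpace E p) := ⟨VectorField.toFun⟩

/-- The derivative `(X F)(p) = dF(p) X(p)` of a function along a vector field. -/
def VectorField.deriv (X : VectorField E M) (F : M → ℝ) (p : M) : ℝ :=
  tangentMap E ℝ F p (X p)

end Manifold

/-! ### Submanifolds -/

section Submanifold

variable {E : Type u} [AddCommGroup E] [Module ℝ E] [TopologicalSpace E]
  {M : Type w} [TopologicalSpace M]

theorem map_mem_of_slice {S : Submodule ℝ E} {N : Set M} {φ : OpenPartialHomeomorph M E}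
    (hφ : φ '' (φ.source ∩ N) = φ.target ∩ S) {x : M} (hx : x ∈ φ.source) (hN : x ∈ N) :
    φ x ∈ S := by
  have h : φ x ∈ φ.target ∩ (S : Set E) := hφ ▸ Set.mem_image_of_mem φ ⟨hx, hN⟩
  exact h.2

theorem symm_mem_of_slice {S : Submodule ℝ E} {N : Set M} {φ : OpenPartialHomeomorph M E}
    (hφ : φ '' (φ.source ∩ N) = φ.target ∩ S) {y : E} (hy : y ∈ φ.target) (hS : y ∈ S) :
    φ.symm y ∈ N := by
  have h : y ∈ φ '' (φ.source ∩ N) := hφ ▸ ⟨hy, hS⟩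
  obtain ⟨x, ⟨hx, hN⟩, rfl⟩ := h
  rwa [φ.left_inv hx]

open Classical in
/-- If `φ(U ∩ N) = φ(U) ∩ S` for a chart `φ` with domain `U` and a subspace `S` of `E`, then `φ`
restricts to a homeomorphism from `U ∩ N`, which is open in `N`, onto `φ(U) ∩ S`, which is open
in `S`. (The values outside of these sets are irrelevant.) -/
def restrictChart (S : Submodule ℝ E) (N : Set M) (φ : OpenPartialHomeomorph M E)
    (hφ : φ '' (φ.source ∩ N) = φ.target ∩ S) (n₀ : N) : OpenPartialHomeomorph N S where
  toFun x := if hx : (x : M) ∈ φ.source then ⟨φ x, map_mem_of_slice hφ hx x.2⟩ else 0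
  invFun y := if hy : (y : E) ∈ φ.target then ⟨φ.symm y, symm_mem_of_slice hφ hy y.2⟩ else n₀
  source := Subtype.val ⁻¹' φ.source
  target := Subtype.val ⁻¹' φ.target
  map_source' x hx := by
    have hx' : (x : M) ∈ φ.source := hx
    simp [hx']
  map_target' y hy := by
    have hy' : (y : E) ∈ φ.target := hy
    simp [hy']
  left_inv' x hx := by
    have hx' : (x : M) ∈ φ.source := hx
    simp [hx']
  right_inv' y hy := by
    have hy' : (y : E) ∈ φ.target := hy
    simp [hy']
  open_source := φ.open_source.preimage continuous_subtype_val
  open_target := φ.open_target.preimage continuous_subtype_val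
  continuousOn_toFun := by
    rw [Topology.IsInducing.subtypeVal.continuousOn_iff]
    refine (φ.continuousOn.comp continuous_subtype_val.continuousOn
      (fun x hx => hx)).congr ?_
    intro x hx
    have hx' : (x : M) ∈ φ.source := hx
    simp [hx']
  continuousOn_invFun := by
    rw [Topology.IsInducing.subtypeVal.continuousOn_iff]
    refine (φ.symm.continuousOn.comp continuous_subtype_val.continuousOn
      (fun x hx => hx)).congr ?_
    intro y hy
    have hy' : (y : E) ∈ φ.target := hy
    simp [hy']

variable (E M) [ChartedSpace E M]

/-- A submanifold of a manifold modeled on `E`: a subset `N` of `M` for which there is a closed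
subspace `S` of `E` such that around every point of `N` there is an `E`-chart `(φ, U)` of `M` with
`φ(U ∩ N) = φ(U) ∩ S`. -/
structure Submanifold where
  carrier : Set M
  model : Submodule ℝ E
  isClosed_model : IsClosed (model : Set E)
  exists_slice : ∀ n ∈ carrier, ∃ φ : OpenPartialHomeomorph M E,
    n ∈ φ.source ∧ IsChart E φ ∧ φ '' (φ.source ∩ carrier) = φ.target ∩ model

variable {E M}

/-- The atlas of a submanifold consists of the restrictions of all charts of `M` that are adapted
to it. -/
instance (N : Submanifold E M) : ChartedSpace N.model N.carrier where
  atlas := {ψ | ∃ (φ : OpenPartialHomeomorph M E) (_ : IsChart E φ)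
    (hφ : φ '' (φ.source ∩ N.carrier) = φ.target ∩ N.model) (n₀ : N.carrier),
    ψ = restrictChart N.model N.carrier φ hφ n₀}
  chartAt n := restrictChart N.model N.carrier (N.exists_slice n n.2).choose
    (N.exists_slice n n.2).choose_spec.2.2 n
  mem_chart_source n := (N.exists_slice n n.2).choose_spec.1
  chart_mem_atlas n := ⟨_, (N.exists_slice n n.2).choose_spec.2.1,
    (N.exists_slice n n.2).choose_spec.2.2, n, rfl⟩

/-- The inclusion `N → M`. -/
def Submanifold.incl (N : Submanifold E M) : N.carrier → M := Subtype.val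

/-- The vector `v ∈ T_n(M)` is tangential to `N`, i.e. it lies in `T_n(N)`, regarded as a subspace
of `T_n(M)` by means of the tangent map of the inclusion. -/
def Submanifold.IsTangent (N : Submanifold E M) (n : N.carrier) (v : TSpace E (n : M)) : Prop :=
  ∃ w : TSpace N.model n, tangentMap N.model E N.incl n w = v

end Submanifold

/-! ### Weak Poisson structures -/

section Poisson

variable (E : Type u) [AddCommGroup E] [Module ℝ E] [TopologicalSpace E]
  (M : Type w) [TopologicalSpace M] [ChartedSpace E M]

/-- A weak Poisson structure on `M`: a unital subalgebra of `C^∞(M, ℝ)` with a Poisson bracket,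
such that the differentials of its elements separate the points of every tangent space, and such
that every element has a smooth Hamiltonian vector field. -/
structure WeakPoissonStructure where
  algebra : Subalgebra ℝ (M → ℝ)
  smooth : ∀ F ∈ algebra, IsSmooth E ℝ F
  bracket : algebra →ₗ[ℝ] algebra →ₗ[ℝ] algebra
  skew : ∀ F G, bracket F G = - bracket G F
  jacobi : ∀ F G H,
    bracket F (bracket G H) = bracket (bracket F G) H + bracket G (bracket F H)
  leibniz : ∀ F G H, bracket F (G * H) = bracket F G * H + G * bracket F H
  separating : ∀ (m : M) (v : TSpace E m),
    (∀ F ∈ algebra, tangentMap E ℝ F m v = 0) → v = 0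
  exists_hamiltonian : ∀ H : algebra, ∃ X : VectorField E M,
    ∀ F : algebra, X.deriv (F : M → ℝ) = (bracket F H : M → ℝ)

variable {E M}

/-- The Hamiltonian vector field `X_H` of `H`, determined by `X_H F = {F, H}` for all `F` in the
algebra (it is unique because differentials separate tangent vectors). -/
def WeakPoissonStructure.hamiltonian (P : WeakPoissonStructure E M) (H : P.algebra) :
    VectorField E M :=
  (P.exists_hamiltonian H).choose

/-- Poisson maps `φ : M → M'`: smooth, with `φ^* A_{M'} ⊆ A_M` and
`φ^*{F, G} = {φ^* F, φ^* G}`. -/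
def IsPoissonMap {E' : Type v} [AddCommGroup E'] [Module ℝ E'] [TopologicalSpace E']
    {M' : Type*} [TopologicalSpace M'] [ChartedSpace E' M']
    (P : WeakPoissonStructure E M) (P' : WeakPoissonStructure E' M') (φ : M → M') : Prop :=
  IsSmooth E E' φ ∧
  ∃ h : ∀ F : P'.algebra, (F : M' → ℝ) ∘ φ ∈ P.algebra,
    ∀ F G : P'.algebra,
      (P'.bracket F G : M' → ℝ) ∘ φ = (P.bracket ⟨_, h F⟩ ⟨_, h G⟩ : M → ℝ)

/-- The ideal `I_N` of all functions in the algebra of a weak Poisson structure which vanish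
on `N`. -/
def vanishingIdeal (P : WeakPoissonStructure E M) (N : Set M) : Ideal P.algebra where
  carrier := {F | ∀ n ∈ N, (F : M → ℝ) n = 0}
  zero_mem' := fun _ _ => rfl
  add_mem' := fun {F G} hF hG n hn => by simp [hF n hn, hG n hn]
  smul_mem' := fun F G hG n hn => by simp [hG n hn]

end Poisson

end

end LC

/-!
A function vanishing on `N` has vanishing derivative in all directions tangential to `N`. As
`{F, G} = X_G F` and `X_G` is tangential, `I_N` is a Poisson ideal (`bracket_mem_vanishingIdeal`),
so the bracket descends to restrictions of functions. A vector tangential to `N` that is annihilated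
by all `d(F|_N)` is annihilated by all `dF`, hence is zero, and the fields `X_F|_N`, read in adapted
charts, are smooth with values in the model space of `N`, hence are Hamiltonian fields on `N`
(`Submanifold.exists_restrict_vectorField`). Together this gives `WeakPoissonStructure.restrict`.

All of this rests on the chain rule and on the smoothness of compositions in locally convex spaces,
which are proved here from the definition of smoothness by iterated directional derivatives.

* `tendsto_diffQuot`: difference quotients of a continuously differentiable map converge locally
  uniformly in base point and direction. This follows from the mean value theorem, which the
  Hahn–Banach theorem reduces to functions of one real variable; no completeness or integration is
  needed. It implies the chain rule and the additivity of the differential.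
* `smoothOn_iff`: the iterated directional derivatives of `f` all exist and are jointly continuous
  if and only if `f` is `C^n` for all `n` in the recursive sense of `IsCn`, in which `C^(n+1)` means
  that `df : U × E → F` is `C^n`. For this one differentiates
  `(x, h₁, …, h_j) ↦ (∂_{h_j} ⋯ ∂_{h_1} f)(x)` in all variables, using its multilinearity in the
  directions. The recursive notion is visibly stable under composition (`IsCn.comp`), and, a
  submanifold being modeled on a closed subspace, under corestriction to such a subspace
  (`IsCn.of_subtypeVal`).
-/

namespace LC

set_option linter.unusedSectionVars false

universe u v w

/-! ### Directional derivatives -/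

section DirDeriv

variable {E : Type*} [AddCommGroup E] [Module ℝ E] [TopologicalSpace E]
  {F : Type*} [AddCommGroup F] [Module ℝ F] [TopologicalSpace F]
  {G : Type*} [AddCommGroup G] [Module ℝ G] [TopologicalSpace G]

theorem HasDirDeriv.unique [T2Space F] {f : E → F} {x h : E} {v w : F}
    (hv : HasDirDeriv f x h v) (hw : HasDirDeriv f x h w) : v = w :=
  tendsto_nhds_unique hv hw

theorem HasDirDeriv.dirDeriv_eq [T2Space F] {f : E → F} {x h : E} {v : F}
    (hv : HasDirDeriv f x h v) : dirDeriv f x h = v :=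
  hv.limUnder_eq

theorem HasDirDeriv.of_exists {f : E → F} {x h : E}
    (hv : ∃ v, HasDirDeriv f x h v) : HasDirDeriv f x h (dirDeriv f x h) :=
  tendsto_nhds_limUnder hv

theorem tendsto_line [ContinuousAdd E] [ContinuousSMul ℝ E] (x h : E) :
    Tendsto (fun t : ℝ => x + t • h) (𝓝 0) (𝓝 x) := by
  have : Continuous fun t : ℝ => x + t • h := by fun_prop
  simpa using this.tendsto 0

section Congr

variable [ContinuousAdd E] [ContinuousSMul ℝ E]

theorem diffQuot_eventuallyEq {f g : E → F} {x : E} (hfg : f =ᶠ[𝓝 x] g) (h : E) :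
    (fun t : ℝ => t⁻¹ • (f (x + t • h) - f x)) =ᶠ[𝓝[≠] 0]
      fun t : ℝ => t⁻¹ • (g (x + t • h) - g x) := by
  have := ((tendsto_line x h).mono_left nhdsWithin_le_nhds).eventually hfg
    (l₁ := 𝓝[≠] (0 : ℝ))
  filter_upwards [this] with t ht
  rw [ht, hfg.eq_of_nhds]

theorem HasDirDeriv.congr {f g : E → F} {x h : E} {v : F} (hf : HasDirDeriv f x h v)
    (hfg : f =ᶠ[𝓝 x] g) : HasDirDeriv g x h v :=
  Tendsto.congr' (diffQuot_eventuallyEq hfg h) hf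

theorem dirDeriv_congr {f g : E → F} {x : E} (hfg : f =ᶠ[𝓝 x] g) (h : E) :
    dirDeriv f x h = dirDeriv g x h := by
  unfold dirDeriv limUnder
  rw [Filter.map_congr (diffQuot_eventuallyEq hfg h)]

end Congr

theorem HasDirDeriv.smul_dir [ContinuousConstSMul ℝ F] {f : E → F} {x h : E} {v : F}
    (hf : HasDirDeriv f x h v) (c : ℝ) : HasDirDeriv f x (c • h) (c • v) := by
  rcases eq_or_ne c 0 with rfl | hc
  · simpa [HasDirDeriv] using tendsto_const_nhds
  · have h1 : Tendsto (fun t : ℝ => t * c) (𝓝[≠] 0) (𝓝[≠] 0) := by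
      refine tendsto_nhdsWithin_iff.2 ⟨?_, ?_⟩
      · have : Continuous fun t : ℝ => t * c := by fun_prop
        simpa using (this.tendsto 0).mono_left nhdsWithin_le_nhds
      · filter_upwards [self_mem_nhdsWithin] with t ht
        exact mul_ne_zero ht hc
    refine ((Tendsto.comp hf h1).const_smul c).congr fun t => ?_
    simp only [Function.comp, smul_smul, mul_inv]
    rw [mul_comm t⁻¹, ← mul_assoc, mul_inv_cancel₀ hc, one_mul]

theorem HasDirDeriv.const_smul [ContinuousConstSMul ℝ F] {f : E → F} {x h : E} {v : F}
    (hf : HasDirDeriv f x h v) (c : ℝ) : HasDirDeriv (fun y => c • f y) x h (c • v) :=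
  (Tendsto.const_smul hf c).congr fun t => by rw [← smul_sub, smul_comm]

theorem HasDirDeriv.add [ContinuousAdd F] {f g : E → F} {x h : E} {v w : F}
    (hf : HasDirDeriv f x h v) (hg : HasDirDeriv g x h w) :
    HasDirDeriv (fun y => f y + g y) x h (v + w) :=
  (Tendsto.add hf hg).congr fun t => by rw [← smul_add, add_sub_add_comm]

theorem HasDirDeriv.prodMk {f : E → F} {g : E → G} {x h : E} {v : F} {w : G}
    (hf : HasDirDeriv f x h v) (hg : HasDirDeriv g x h w) :
    HasDirDeriv (fun y => (f y, g y)) x h (v, w) :=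
  Tendsto.prodMk_nhds hf hg

theorem HasDirDeriv.clm_comp {f : E → F} {x h : E} {v : F} (hf : HasDirDeriv f x h v)
    (L : F →L[ℝ] G) : HasDirDeriv (fun y => L (f y)) x h (L v) :=
  ((L.continuous.tendsto v).comp hf).congr fun t => by simp

theorem hasDirDeriv_comp_clm {f : F → G} {L : E →L[ℝ] F} {x h : E} {v : G} :
    HasDirDeriv (fun y => f (L y)) x h v ↔ HasDirDeriv f (L x) (L h) v := by
  simp [HasDirDeriv]

theorem dirDeriv_comp_clm (f : F → G) (L : E →L[ℝ] F) (x h : E) :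
    dirDeriv (fun y => f (L y)) x h = dirDeriv f (L x) (L h) := by
  simp [dirDeriv]

theorem HasDirDeriv.of_subtypeVal {S : Submodule ℝ F} (hS : IsClosed (S : Set F)) {f : E → S}
    {x h : E} {v : F} (hf : HasDirDeriv (fun y => (f y : F)) x h v) :
    ∃ w : S, (w : F) = v ∧ HasDirDeriv f x h w := by
  have hv : v ∈ S := hS.mem_of_tendsto hf (Eventually.of_forall fun t =>
    S.smul_mem _ (S.sub_mem (f _).2 (f _).2))
  exact ⟨⟨v, hv⟩, rfl, tendsto_subtype_rng.2 hf⟩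

/-! ### The mean value theorem and its consequences -/

section MeanValue

variable [IsTopologicalAddGroup G] [ContinuousSMul ℝ G] [LocallyConvexSpace ℝ G]

/-- Mean value theorem: the Hahn–Banach theorem reduces it to real-valued functions. -/
theorem sub_mem_of_hasDirDeriv {f : F → G} {x h : F} {D : ℝ → G} {C : Set G}
    (hC : Convex ℝ C) (hC' : IsClosed C)
    (hf : ∀ s ∈ Set.Icc (0 : ℝ) 1, HasDirDeriv f (x + s • h) h (D s))
    (hD : ∀ s ∈ Set.Icc (0 : ℝ) 1, D s ∈ C) : f (x + h) - f x ∈ C := by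
  by_contra hn
  obtain ⟨L, a, hL, hL'⟩ := geometric_hahn_banach_point_closed hC hC' hn
  have hder : ∀ s ∈ Set.Icc (0 : ℝ) 1,
      HasDerivAt (fun s : ℝ => L (f (x + s • h))) (L (D s)) s := by
    intro s hs
    rw [hasDerivAt_iff_tendsto_slope_zero]
    refine Tendsto.congr (fun t => ?_) ((hf s hs).clm_comp L)
    simp only [add_smul, add_assoc]
  obtain ⟨c, hc, hcs⟩ := exists_hasDerivAt_eq_slope (fun s : ℝ => L (f (x + s • h)))
    (fun s => L (D s)) zero_lt_one
    (fun s hs => (hder s hs).continuousAt.continuousWithinAt)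
    (fun s hs => hder s (Set.Ioo_subset_Icc_self hs))
  have h1 := hL' _ (hD c (Set.Ioo_subset_Icc_self hc))
  simp only [one_smul, zero_smul, add_zero, sub_zero, div_one] at hcs
  rw [map_sub, ← hcs] at hL
  exact lt_asymm hL h1

/-- Closed convex neighborhoods form a neighborhood basis. -/
theorem exists_convex_isClosed_nhds_subset {v : G} {W : Set G} (hW : W ∈ 𝓝 v) :
    ∃ C ∈ 𝓝 v, Convex ℝ C ∧ IsClosed C ∧ C ⊆ W := by
  obtain ⟨K, ⟨hK, hKc⟩, hKW⟩ := (closed_nhds_basis v).mem_iff.1 hW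
  obtain ⟨B, ⟨hB, hBc⟩, hBK⟩ := ((LocallyConvexSpace.convex_basis (𝕜 := ℝ) v)).mem_iff.1 hK
  exact ⟨closure B, mem_of_superset hB subset_closure, hBc.closure, isClosed_closure,
    (closure_minimal hBK hKc).trans hKW⟩

/-- Difference quotients of a continuously differentiable map converge locally uniformly: base
point, direction and an additional parameter `z` may vary along with the step `t`. -/
theorem tendsto_diffQuot [ContinuousAdd F] [ContinuousSMul ℝ F]
    {Z : Type*} [TopologicalSpace Z]
    {f : Z → F → G} {D : Z → F → F → G} {V : Set F} {z : Z} {y k : F} (hV : V ∈ 𝓝 y)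
    (hf : ∀ z, ∀ x ∈ V, ∀ k, HasDirDeriv (f z) x k (D z x k))
    (hD : ContinuousAt (fun q : Z × F × F => D q.1 q.2.1 q.2.2) (z, y, k)) :
    Tendsto (fun q : Z × F × ℝ × F =>
        q.2.2.1⁻¹ • (f q.1 (q.2.1 + q.2.2.1 • q.2.2.2) - f q.1 q.2.1))
      (𝓝 z ×ˢ 𝓝 y ×ˢ 𝓝[≠] 0 ×ˢ 𝓝 k) (𝓝 (D z y k)) := by
  refine tendsto_def.2 fun W hW => ?_
  obtain ⟨C, hC, hCc, hCcl, hCW⟩ := exists_convex_isClosed_nhds_subset hW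
  have h1 : ∀ᶠ q in 𝓝 (z, y, k), q.2.1 ∈ V ∧ D q.1 q.2.1 q.2.2 ∈ C :=
    Filter.Eventually.and ((show ContinuousAt (fun q : Z × F × F => q.2.1) (z, y, k) by
      fun_prop).eventually_mem hV) (hD.eventually_mem hC)
  have hcont : Tendsto (fun q : Z × F × ℝ × F => (q.1, q.2.1 + q.2.2.1 • q.2.2.2, q.2.2.2))
      (𝓝 (z, y, 0, k)) (𝓝 (z, y, k)) := by
    have : Continuous (fun q : Z × F × ℝ × F => (q.1, q.2.1 + q.2.2.1 • q.2.2.2, q.2.2.2)) := by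
      fun_prop
    simpa using this.tendsto (z, y, (0 : ℝ), k)
  have h2 := hcont.eventually h1
  simp only [nhds_prod_eq] at h2
  rw [((𝓝 z).basis_sets.prod ((𝓝 y).basis_sets.prod
    (Metric.nhds_basis_ball.prod (𝓝 k).basis_sets))).eventually_iff] at h2
  -- By continuity, for all points near `y`, steps below `δ` and directions near `k`, the derivatives
  -- along the whole segment lie in `C`.
  obtain ⟨⟨A, B, δ, K⟩, ⟨hA, hB, hδ, hK⟩, h2⟩ := h2
  have hδ' : Metric.ball (0 : ℝ) δ ∩ {0}ᶜ ∈ 𝓝[≠] (0 : ℝ) :=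
    inter_mem (mem_nhdsWithin_of_mem_nhds (Metric.ball_mem_nhds _ hδ)) self_mem_nhdsWithin
  filter_upwards [prod_mem_prod hA (prod_mem_prod hB (prod_mem_prod hδ' hK))]
  rintro ⟨z', y', t, k'⟩ ⟨hz', hy', ⟨ht, ht0⟩, hk'⟩
  have ht0 : t ≠ 0 := ht0
  simp only [Metric.mem_ball, dist_zero_right, Real.norm_eq_abs] at ht
  have key : ∀ s ∈ Set.Icc (0 : ℝ) 1, y' + s • (t • k') ∈ V ∧ D z' (y' + s • (t • k')) k' ∈ C := by
    intro s hs
    have hst : s * t ∈ Metric.ball (0 : ℝ) δ := by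
      simp only [Metric.mem_ball, dist_zero_right, Real.norm_eq_abs, abs_mul]
      rw [abs_of_nonneg hs.1]
      exact (mul_le_of_le_one_left (abs_nonneg t) hs.2).trans_lt ht
    have := h2 (x := (z', y', s * t, k')) ⟨hz', hy', hst, hk'⟩
    simpa [smul_smul] using this
  apply hCW
  -- The step `t • k'` is absorbed into the function, so that its derivatives lie in `C`.
  have := sub_mem_of_hasDirDeriv (f := fun x => t⁻¹ • f z' x) (x := y') (h := t • k')
    (D := fun s => D z' (y' + s • (t • k')) k') hCc hCcl
    (fun s hs => by
      have := (((hf z' _ (key s hs).1 k').smul_dir t).const_smul t⁻¹)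
      rwa [inv_smul_smul₀ ht0] at this) (fun s hs => (key s hs).2)
  simpa [smul_sub] using this

variable [ContinuousAdd F] [ContinuousSMul ℝ F]

/-- The chain rule. -/
theorem HasDirDeriv.comp {g : F → G} {D : F → F → G} {f : E → F} {x h : E} {v : F} {V : Set F}
    (hV : V ∈ 𝓝 (f x)) (hg : ∀ y ∈ V, ∀ k, HasDirDeriv g y k (D y k))
    (hD : ContinuousAt (fun q : F × F => D q.1 q.2) (f x, v)) (hf : HasDirDeriv f x h v) :
    HasDirDeriv (fun y => g (f y)) x h (D (f x) v) := by
  have h1 := tendsto_diffQuot (Z := Unit) (f := fun _ => g) (D := fun _ => D) (z := ()) (k := v)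
    hV (fun _ => hg)
    (ContinuousAt.comp (g := fun q : F × F => D q.1 q.2) (f := Prod.snd) hD continuousAt_snd)
  have h2 : Tendsto (fun t : ℝ => ((), f x, t, t⁻¹ • (f (x + t • h) - f x))) (𝓝[≠] 0)
      (𝓝 () ×ˢ 𝓝 (f x) ×ˢ 𝓝[≠] 0 ×ˢ 𝓝 v) :=
    tendsto_const_nhds.prodMk (tendsto_const_nhds.prodMk (tendsto_id.prodMk hf))
  refine (h1.comp h2).congr' ?_
  filter_upwards [self_mem_nhdsWithin] with t ht
  have ht : t ≠ 0 := ht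
  simp [smul_smul, ht]

/-- Continuous directional derivatives are additive in the direction. -/
theorem HasDirDeriv.add_dir {f : F → G} {D : F → F → G} {x h k : F} {V : Set F}
    (hV : V ∈ 𝓝 x) (hf : ∀ y ∈ V, ∀ k, HasDirDeriv f y k (D y k))
    (hD : ContinuousAt (fun q : F × F => D q.1 q.2) (x, k)) :
    HasDirDeriv f x (h + k) (D x h + D x k) := by
  have h1 := tendsto_diffQuot (Z := Unit) (f := fun _ => f) (D := fun _ => D) (z := ()) (k := k)
    hV (fun _ => hf)
    (ContinuousAt.comp (g := fun q : F × F => D q.1 q.2) (f := Prod.snd) hD continuousAt_snd)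
  have h2 : Tendsto (fun t : ℝ => ((), x + t • h, t, k)) (𝓝[≠] 0)
      (𝓝 () ×ˢ 𝓝 x ×ˢ 𝓝[≠] 0 ×ˢ 𝓝 k) :=
    tendsto_const_nhds.prodMk (((tendsto_line x h).mono_left nhdsWithin_le_nhds).prodMk
      (tendsto_id.prodMk tendsto_const_nhds))
  refine (Tendsto.add (hf x (mem_of_mem_nhds hV) h) (h1.comp h2)).congr fun t => ?_
  simp only [Function.comp, ← smul_add, add_assoc]
  congr 1
  abel

end MeanValue

end DirDeriv

/-! ### Maps of finite order of differentiability -/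

/-- `f` is a `C^n`-map on `U`, defined by recursion: `f` is `C^(n+1)` if it is continuous with
directional derivatives such that `df : U × E → F` is `C^n`. In contrast to the iterated
derivatives with fixed directions in `SmoothOn`, the differential is taken here with respect to
the pair of point and direction, so that proofs by induction on `n` are possible. -/
def IsCn {F : Type v} [AddCommGroup F] [Module ℝ F] [TopologicalSpace F] :
    ℕ → ∀ {E : Type u} [AddCommGroup E] [Module ℝ E] [TopologicalSpace E],
      (E → F) → Set E → Prop
  | 0, _, _, _, _, f, U => ContinuousOn f U
  | n + 1, E, _, _, _, f, U => ContinuousOn f U ∧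
      (∀ x ∈ U, ∀ h, HasDirDeriv f x h (dirDeriv f x h)) ∧
      IsCn n (fun p : E × E => dirDeriv f p.1 p.2) (U ×ˢ Set.univ)

section IsCn

variable {F : Type v} [AddCommGroup F] [Module ℝ F] [TopologicalSpace F]
  {G : Type w} [AddCommGroup G] [Module ℝ G] [TopologicalSpace G]
  {n : ℕ}

theorem IsCn.continuousOn {E : Type u} [AddCommGroup E] [Module ℝ E] [TopologicalSpace E]
    {f : E → F} {U : Set E} (hf : IsCn n f U) : ContinuousOn f U := by
  cases n with
  | zero => exact hf
  | succ n => exact hf.1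

theorem IsCn.of_succ {E : Type u} [AddCommGroup E] [Module ℝ E] [TopologicalSpace E]
    {f : E → F} {U : Set E} (hf : IsCn (n + 1) f U) : IsCn n f U := by
  induction n generalizing E with
  | zero => exact hf.1
  | succ n ih => exact ⟨hf.1, hf.2.1, ih hf.2.2⟩

theorem IsCn.mono {E : Type u} [AddCommGroup E] [Module ℝ E] [TopologicalSpace E]
    {f : E → F} {U V : Set E} (hf : IsCn n f U) (hV : V ⊆ U) : IsCn n f V := by
  induction n generalizing E with
  | zero => exact ContinuousOn.mono hf hV
  | succ n ih => exact ⟨hf.1.mono hV, fun x hx => hf.2.1 x (hV hx),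
      ih hf.2.2 (Set.prod_mono hV subset_rfl)⟩

theorem IsCn.congr {E : Type u} [AddCommGroup E] [Module ℝ E] [TopologicalSpace E]
    [ContinuousAdd E] [ContinuousSMul ℝ E] {f g : E → F} {U : Set E} (hU : IsOpen U)
    (hf : IsCn n f U) (hfg : Set.EqOn f g U) : IsCn n g U := by
  induction n generalizing E with
  | zero => exact ContinuousOn.congr hf hfg.symm
  | succ n ih =>
    have he : ∀ x ∈ U, f =ᶠ[𝓝 x] g := fun x hx => hfg.eventuallyEq_of_mem (hU.mem_nhds hx)
    refine ⟨hf.1.congr hfg.symm, fun x hx h => ?_, ?_⟩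
    · rw [← dirDeriv_congr (he x hx) h]
      exact (hf.2.1 x hx h).congr (he x hx)
    · exact ih (hU.prod isOpen_univ) hf.2.2 fun p hp => dirDeriv_congr (he p.1 hp.1) p.2

theorem IsCn.of_locally {E : Type u} [AddCommGroup E] [Module ℝ E] [TopologicalSpace E]
    {f : E → F} {U : Set E} (hf : ∀ x ∈ U, ∃ V, IsOpen V ∧ x ∈ V ∧ IsCn n f V) : IsCn n f U := by
  induction n generalizing E with
  | zero =>
    intro x hx
    obtain ⟨V, hV, hxV, hfV⟩ := hf x hx
    exact (ContinuousOn.continuousAt hfV (hV.mem_nhds hxV)).continuousWithinAt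
  | succ n ih =>
    refine ⟨fun x hx => ?_, fun x hx h => ?_, ih fun p hp => ?_⟩
    · obtain ⟨V, hV, hxV, hfV⟩ := hf x hx
      exact (hfV.1.continuousAt (hV.mem_nhds hxV)).continuousWithinAt
    · obtain ⟨V, hV, hxV, hfV⟩ := hf x hx
      exact hfV.2.1 x hxV h
    · obtain ⟨V, hV, hxV, hfV⟩ := hf p.1 hp.1
      exact ⟨V ×ˢ Set.univ, hV.prod isOpen_univ, ⟨hxV, trivial⟩, hfV.2.2⟩

theorem IsCn.clm_comp [T2Space G] {E : Type u} [AddCommGroup E] [Module ℝ E] [TopologicalSpace E]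
    [ContinuousAdd E] [ContinuousSMul ℝ E] {f : E → F} {U : Set E} (hU : IsOpen U)
    (hf : IsCn n f U) (L : F →L[ℝ] G) : IsCn n (fun x => L (f x)) U := by
  induction n generalizing E with
  | zero => exact L.continuous.comp_continuousOn hf
  | succ n ih =>
    have hd : ∀ x ∈ U, ∀ h, HasDirDeriv (fun x => L (f x)) x h (L (dirDeriv f x h)) :=
      fun x hx h => (hf.2.1 x hx h).clm_comp L
    refine ⟨L.continuous.comp_continuousOn hf.1, fun x hx h => .of_exists ⟨_, hd x hx h⟩, ?_⟩
    exact (ih (hU.prod isOpen_univ) hf.2.2).congr (hU.prod isOpen_univ)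
      fun p hp => (hd p.1 hp.1 p.2).dirDeriv_eq.symm

theorem IsCn.comp_clm {E : Type u} [AddCommGroup E] [Module ℝ E] [TopologicalSpace E]
    {F : Type w} [AddCommGroup F] [Module ℝ F] [TopologicalSpace F]
    {G : Type v} [AddCommGroup G] [Module ℝ G] [TopologicalSpace G]
    {f : F → G} {U : Set F} (hf : IsCn n f U) (L : E →L[ℝ] F) :
    IsCn n (fun x => f (L x)) (L ⁻¹' U) := by
  induction n generalizing E F with
  | zero => exact ContinuousOn.comp hf L.continuous.continuousOn (Set.mapsTo_preimage _ _)
  | succ n ih =>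
    refine ⟨hf.1.comp L.continuous.continuousOn (Set.mapsTo_preimage _ _), fun x hx h => ?_, ?_⟩
    · rw [dirDeriv_comp_clm, hasDirDeriv_comp_clm]
      exact hf.2.1 _ hx _
    · simp only [dirDeriv_comp_clm]
      exact (ih hf.2.2 (L.prodMap L)).mono fun p hp => ⟨hp.1, trivial⟩

theorem IsCn.prodMk [T2Space F] [T2Space G] {E : Type u} [AddCommGroup E] [Module ℝ E]
    [TopologicalSpace E] [ContinuousAdd E] [ContinuousSMul ℝ E] {f : E → F} {g : E → G}
    {U : Set E} (hU : IsOpen U) (hf : IsCn n f U) (hg : IsCn n g U) :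
    IsCn n (fun x => (f x, g x)) U := by
  induction n generalizing E with
  | zero => exact ContinuousOn.prodMk hf hg
  | succ n ih =>
    have hd : ∀ x ∈ U, ∀ h,
        HasDirDeriv (fun x => (f x, g x)) x h (dirDeriv f x h, dirDeriv g x h) :=
      fun x hx h => (hf.2.1 x hx h).prodMk (hg.2.1 x hx h)
    refine ⟨hf.1.prodMk hg.1, fun x hx h => .of_exists ⟨_, hd x hx h⟩, ?_⟩
    exact (ih (hU.prod isOpen_univ) hf.2.2 hg.2.2).congr (hU.prod isOpen_univ)
      fun p hp => (hd p.1 hp.1 p.2).dirDeriv_eq.symm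

theorem IsCn.add [ContinuousAdd F] [T2Space F] {E : Type u} [AddCommGroup E] [Module ℝ E]
    [TopologicalSpace E] [ContinuousAdd E] [ContinuousSMul ℝ E] {f g : E → F}
    {U : Set E} (hU : IsOpen U) (hf : IsCn n f U) (hg : IsCn n g U) :
    IsCn n (fun x => f x + g x) U :=
  (hf.prodMk hU hg).clm_comp hU
    (ContinuousLinearMap.fst ℝ F F + ContinuousLinearMap.snd ℝ F F)

theorem isCn_zero {E : Type u} [AddCommGroup E] [Module ℝ E]
    [TopologicalSpace E] [T2Space F] {U : Set E} : IsCn n (fun _ : E => (0 : F)) U := by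
  induction n generalizing E with
  | zero => exact continuousOn_const
  | succ n ih =>
    have hd : ∀ x h : E, HasDirDeriv (fun _ : E => (0 : F)) x h 0 := by simp [HasDirDeriv]
    refine ⟨continuousOn_const, fun x _ h => .of_exists ⟨_, hd x h⟩, ?_⟩
    simpa only [(hd _ _).dirDeriv_eq] using ih

theorem IsCn.sum [ContinuousAdd F] [T2Space F] {E : Type u} [AddCommGroup E] [Module ℝ E]
    [TopologicalSpace E] [ContinuousAdd E] [ContinuousSMul ℝ E] {ι : Type*} (s : Finset ι)
    {f : ι → E → F} {U : Set E} (hU : IsOpen U) (hf : ∀ i ∈ s, IsCn n (f i) U) :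
    IsCn n (fun x => ∑ i ∈ s, f i x) U := by
  classical
  induction s using Finset.induction_on with
  | empty => simpa using isCn_zero
  | insert a s ha ih =>
    simp only [Finset.sum_insert ha]
    exact (hf a (by simp)).add hU (ih fun i hi => hf i (by simp [hi]))

/-- Closedness of `S` ensures that the derivatives of an `S`-valued map lie in `S`. -/
theorem IsCn.of_subtypeVal [T2Space F] {S : Submodule ℝ F} (hS : IsClosed (S : Set F))
    {E : Type u} [AddCommGroup E] [Module ℝ E]
    [TopologicalSpace E] [ContinuousAdd E] [ContinuousSMul ℝ E] {f : E → S}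
    {U : Set E} (hU : IsOpen U) (hf : IsCn n (fun x => (f x : F)) U) : IsCn n f U := by
  induction n generalizing E with
  | zero => exact Topology.IsInducing.subtypeVal.continuousOn_iff.2 hf
  | succ n ih =>
    have hd : ∀ x ∈ U, ∀ h, HasDirDeriv f x h (dirDeriv f x h) ∧
        dirDeriv (fun x => (f x : F)) x h = dirDeriv f x h := by
      intro x hx h
      obtain ⟨w, hw, hfw⟩ := (hf.2.1 x hx h).of_subtypeVal hS
      rw [hfw.dirDeriv_eq]
      exact ⟨hfw, hw.symm⟩
    refine ⟨Topology.IsInducing.subtypeVal.continuousOn_iff.2 hf.1, fun x hx h => (hd x hx h).1,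
      ih (hU.prod isOpen_univ) (hf.2.2.congr (hU.prod isOpen_univ) fun p hp => ?_)⟩
    exact (hd p.1 hp.1 p.2).2

theorem IsCn.comp {E : Type u} [AddCommGroup E] [Module ℝ E] [TopologicalSpace E]
    [ContinuousAdd E] [ContinuousSMul ℝ E]
    {F : Type w} [AddCommGroup F] [Module ℝ F] [TopologicalSpace F]
    [ContinuousAdd F] [ContinuousSMul ℝ F] [T2Space F]
    {G : Type v} [AddCommGroup G] [Module ℝ G] [TopologicalSpace G]
    [IsTopologicalAddGroup G] [ContinuousSMul ℝ G] [LocallyConvexSpace ℝ G] [T2Space G]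
    {g : F → G} {f : E → F} {U : Set E} {V : Set F} (hU : IsOpen U) (hV : IsOpen V)
    (hg : IsCn n g V) (hf : IsCn n f U) (hUV : Set.MapsTo f U V) :
    IsCn n (fun x => g (f x)) U := by
  induction n generalizing E F with
  | zero => exact ContinuousOn.comp hg hf hUV
  | succ n ih =>
    have hd : ∀ x ∈ U, ∀ h,
        HasDirDeriv (fun x => g (f x)) x h (dirDeriv g (f x) (dirDeriv f x h)) :=
      fun x hx h => (hf.2.1 x hx h).comp (hV.mem_nhds (hUV hx)) hg.2.1
        (hg.2.2.continuousOn.continuousAt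
          ((hV.prod isOpen_univ).mem_nhds ⟨hUV hx, trivial⟩))
    refine ⟨hg.1.comp hf.1 hUV, fun x hx h => .of_exists ⟨_, hd x hx h⟩, ?_⟩
    have hU' := hU.prod (isOpen_univ (X := E))
    have h1 : IsCn n (fun p : E × E => f p.1) (U ×ˢ Set.univ) :=
      (hf.of_succ.comp_clm (ContinuousLinearMap.fst ℝ E E)).mono fun p hp => hp.1
    exact (ih hU' (hV.prod isOpen_univ) hg.2.2 (h1.prodMk hU' hf.2.2)
      fun p hp => ⟨hUV hp.1, trivial⟩).congr hU' fun p hp => (hd p.1 hp.1 p.2).dirDeriv_eq.symm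

end IsCn

/-! ### Smooth maps are the maps of all finite orders of differentiability -/

section SmoothOn

variable {E : Type u} [AddCommGroup E] [Module ℝ E] [TopologicalSpace E]
  [IsTopologicalAddGroup E] [ContinuousSMul ℝ E]
  {F : Type v} [AddCommGroup F] [Module ℝ F] [TopologicalSpace F]
  [IsTopologicalAddGroup F] [ContinuousSMul ℝ F] [T2Space F]
  {f : E → F} {U : Set E}

/-- The iterated derivative of order `j + 1` as a restriction of the differential of the one of
order `j`, considered as a function of point and directions. -/
theorem isCn_iterDirDeriv (hf : ∀ n, IsCn n f U) (hU : IsOpen U) (n j : ℕ) :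
    IsCn n (fun p : E × (Fin j → E) => iterDirDeriv f j p.2 p.1) (U ×ˢ Set.univ) := by
  induction j generalizing n with
  | zero =>
    exact ((hf n).comp_clm (ContinuousLinearMap.fst ℝ E (Fin 0 → E))).mono fun p hp => hp.1
  | succ j ih =>
    let L : (E × (Fin (j + 1) → E)) →L[ℝ] (E × (Fin j → E)) × (E × (Fin j → E)) :=
      { toFun := fun p => ((p.1, Fin.init p.2), (p.2 (Fin.last j), 0))
        map_add' := fun p q => by ext <;> simp [Fin.init]
        map_smul' := fun c p => by ext <;> simp [Fin.init]
        cont := by unfold Fin.init; fun_prop }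
    refine (((ih (n + 1)).2.2.comp_clm L).mono fun p hp => ⟨⟨hp.1, trivial⟩, trivial⟩).congr
      (hU.prod isOpen_univ) fun p hp => ?_
    simp [L, dirDeriv, iterDirDeriv]

theorem SmoothOn.of_isCn (hU : IsOpen U) (hf : ∀ n, IsCn n f U) : SmoothOn f U := by
  refine fun j => ⟨fun h x hx k => ?_, (isCn_iterDirDeriv hf hU 0 j).continuousOn⟩
  have := (isCn_iterDirDeriv hf hU 1 j).2.1 (x, h) ⟨hx, trivial⟩ (k, 0)
  exact ⟨_, by simpa [HasDirDeriv] using this⟩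

/-- Here `Fin.snoc h k` appends the direction `k`, which is differentiated last. -/
theorem hasDirDeriv_iterDirDeriv (hf : SmoothOn f U) {j : ℕ} (h : Fin j → E) {x : E} (hx : x ∈ U)
    (k : E) : HasDirDeriv (iterDirDeriv f j h) x k (iterDirDeriv f (j + 1) (Fin.snoc h k) x) := by
  simpa [iterDirDeriv] using HasDirDeriv.of_exists ((hf j).1 h x hx k)

theorem hasDirDeriv_iterDirDeriv_update (hf : SmoothOn f U) {j : ℕ} (h : Fin (j + 1) → E) {x : E}
    (hx : x ∈ U) (i : Fin j) (c : E) :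
    HasDirDeriv (iterDirDeriv f j (Function.update (Fin.init h) i c)) x (h (Fin.last j))
      (iterDirDeriv f (j + 1) (Function.update h i.castSucc c) x) := by
  have h1 := hasDirDeriv_iterDirDeriv hf (Fin.init (Function.update h i.castSucc c)) hx
    (Function.update h i.castSucc c (Fin.last j))
  rwa [Fin.snoc_init_self, Fin.init_update_castSucc,
    Function.update_of_ne (Fin.castSucc_ne_last i).symm] at h1

theorem continuousAt_iterDirDeriv_snoc (hf : SmoothOn f U) (hU : IsOpen U) {j : ℕ}
    (h : Fin j → E) {x : E} (hx : x ∈ U) (k : E) :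
    ContinuousAt (fun q : (Fin j → E) × E × E =>
      iterDirDeriv f (j + 1) (Fin.snoc q.1 q.2.2) q.2.1) (h, x, k) := by
  have h1 : ContinuousAt (fun p : E × (Fin (j + 1) → E) => iterDirDeriv f (j + 1) p.2 p.1)
      (x, Fin.snoc h k) :=
    (hf (j + 1)).2.continuousAt ((hU.prod isOpen_univ).mem_nhds ⟨hx, trivial⟩)
  have h2 : Continuous (fun q : (Fin j → E) × E × E =>
      ((q.2.1, Fin.snoc q.1 q.2.2) : E × (Fin (j + 1) → E))) :=
    continuous_snd.fst.prodMk (Continuous.finSnoc (A := fun _ => E) continuous_fst continuous_snd.snd)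
  generalize iterDirDeriv f (j + 1) = D at h1 ⊢
  exact ContinuousAt.comp (g := fun p : E × (Fin (j + 1) → E) => D p.2 p.1)
    (x := (h, x, k)) h1 h2.continuousAt

variable [LocallyConvexSpace ℝ F]

/-- Additivity in the last direction is additivity of the differential; in an earlier one it is
obtained by differentiating the identity of order `j - 1`. -/
theorem iterDirDeriv_update_add (hf : SmoothOn f U) (hU : IsOpen U) {j : ℕ}
    (h : Fin j → E) {x : E} (hx : x ∈ U) (i : Fin j) (a b : E) :
    iterDirDeriv f j (Function.update h i (a + b)) x =
      iterDirDeriv f j (Function.update h i a) x + iterDirDeriv f j (Function.update h i b) x := by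
  induction j generalizing x with
  | zero => exact i.elim0
  | succ j ih =>
    induction i using Fin.lastCases with
    | last =>
      have := (HasDirDeriv.add_dir (h := a) (hU.mem_nhds hx)
        (fun y hy k => hasDirDeriv_iterDirDeriv hf (Fin.init h) hy k)
        ((continuousAt_iterDirDeriv_snoc hf hU (Fin.init h) hx b).comp
          (f := fun q : E × E => (Fin.init h, q)) (x := (x, b)) (by fun_prop))).dirDeriv_eq
      simpa [iterDirDeriv] using this
    | cast i =>
      have h1 := hasDirDeriv_iterDirDeriv_update hf h hx i
      refine (h1 (a + b)).unique (((h1 a).add (h1 b)).congr ?_)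
      filter_upwards [hU.mem_nhds hx] with y hy using (ih _ hy i).symm

theorem iterDirDeriv_update_smul (hf : SmoothOn f U) (hU : IsOpen U) {j : ℕ}
    (h : Fin j → E) {x : E} (hx : x ∈ U) (i : Fin j) (c : ℝ) (a : E) :
    iterDirDeriv f j (Function.update h i (c • a)) x =
      c • iterDirDeriv f j (Function.update h i a) x := by
  induction j generalizing x with
  | zero => exact i.elim0
  | succ j ih =>
    induction i using Fin.lastCases with
    | last =>
      have := ((hasDirDeriv_iterDirDeriv hf (Fin.init h) hx a).smul_dir c).dirDeriv_eq
      simpa [iterDirDeriv] using this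
    | cast i =>
      have h1 := hasDirDeriv_iterDirDeriv_update hf h hx i
      refine (h1 (c • a)).unique (((h1 a).const_smul c).congr ?_)
      filter_upwards [hU.mem_nhds hx] with y hy using (ih _ hy i).symm

/-- The iterated derivative at a fixed point as a multilinear map of the directions. -/
noncomputable def iterDirDerivMultilinear (hf : SmoothOn f U) (hU : IsOpen U) (j : ℕ) {x : E}
    (hx : x ∈ U) : MultilinearMap ℝ (fun _ : Fin j => E) F where
  toFun h := iterDirDeriv f j h x
  map_update_add' h i a b := by
    convert iterDirDeriv_update_add hf hU h hx i a b
  map_update_smul' h i c a := by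
    convert iterDirDeriv_update_smul hf hU h hx i c a

/-- A multilinear map is a polynomial along lines, so no continuity is needed here. -/
theorem hasDirDeriv_multilinearMap {j : ℕ} (A : MultilinearMap ℝ (fun _ : Fin j => E) F)
    (h l : Fin j → E) : HasDirDeriv A h l (A.linearDeriv h l) := by
  have h1 : ∀ s : Finset (Fin j), 2 ≤ s.card →
      Tendsto (fun t : ℝ => t ^ (s.card - 1) • A (s.piecewise l h)) (𝓝[≠] 0) (𝓝 0) := by
    intro s hs
    have : Continuous fun t : ℝ => t ^ (s.card - 1) • A (s.piecewise l h) := by fun_prop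
    have := (this.tendsto 0).mono_left (nhdsWithin_le_nhds (s := {0}ᶜ))
    rwa [zero_pow (by omega), zero_smul] at this
  have h2 := tendsto_const_nhds (x := A.linearDeriv h l) (f := 𝓝[≠] (0 : ℝ)) |>.add
    (tendsto_finsetSum (Finset.univ.filter fun s : Finset (Fin j) => 2 ≤ s.card)
      fun s hs => h1 s (Finset.mem_filter.1 hs).2)
  simp only [Finset.sum_const_zero, add_zero] at h2
  refine h2.congr' ?_
  filter_upwards [self_mem_nhdsWithin] with t ht
  have ht : t ≠ 0 := ht
  rw [A.map_add_eq_map_add_linearDeriv_add, map_smul, add_assoc, add_sub_cancel_left, smul_add,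
    inv_smul_smul₀ ht, Finset.smul_sum]
  congr 1
  refine Finset.sum_congr rfl fun s hs => ?_
  have hs := (Finset.mem_filter.1 hs).2
  have h3 : A (s.piecewise (t • l) h) = t ^ s.card • A (s.piecewise l h) := by
    have := A.map_piecewise_smul (fun _ => t) (s.piecewise l h) s
    rw [Finset.prod_const] at this
    rw [← this]
    congr 1
    ext i
    by_cases hi : i ∈ s <;> simp [hi]
  rw [h3, smul_smul]
  congr 1
  obtain ⟨m, hm⟩ : ∃ m, s.card = m + 1 := ⟨s.card - 1, by omega⟩
  rw [hm, pow_succ, add_tsub_cancel_right]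
  field_simp

/-- The differential of the iterated derivative with respect to point and directions. -/
theorem hasDirDeriv_iterDirDeriv_prod (hf : SmoothOn f U) (hU : IsOpen U) {j : ℕ}
    (h l : Fin j → E) {x : E} (hx : x ∈ U) (k : E) :
    HasDirDeriv (fun p : E × (Fin j → E) => iterDirDeriv f j p.2 p.1) (x, h) (k, l)
      (iterDirDeriv f (j + 1) (Fin.snoc h k) x +
        ∑ i, iterDirDeriv f j (Function.update h i (l i)) x) := by
  -- The increment splits into one in the point, with the directions as parameters of the
  -- difference quotient, and one in the directions, where the map is multilinear.
  have h1 := tendsto_diffQuot (f := iterDirDeriv f j)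
    (D := fun h x k => iterDirDeriv f (j + 1) (Fin.snoc h k) x) (z := h) (k := k)
    (hU.mem_nhds hx) (fun h y hy k => hasDirDeriv_iterDirDeriv hf h hy k)
    (continuousAt_iterDirDeriv_snoc hf hU h hx k)
  have h2 : Tendsto (fun t : ℝ => (h + t • l, x, t, k)) (𝓝[≠] 0)
      (𝓝 h ×ˢ 𝓝 x ×ˢ 𝓝[≠] 0 ×ˢ 𝓝 k) :=
    ((tendsto_line h l).mono_left nhdsWithin_le_nhds).prodMk
      (tendsto_const_nhds.prodMk (tendsto_id.prodMk tendsto_const_nhds))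
  have h3 := hasDirDeriv_multilinearMap (iterDirDerivMultilinear hf hU j hx) h l
  rw [MultilinearMap.linearDeriv_apply] at h3
  refine (Tendsto.add (h1.comp h2) h3).congr fun t => ?_
  simp only [Function.comp, ← smul_add, iterDirDerivMultilinear, MultilinearMap.coe_mk,
    sub_add_sub_cancel]
  rfl

theorem SmoothOn.isCn_iterDirDeriv (hf : SmoothOn f U) (hU : IsOpen U) (n j : ℕ) :
    IsCn n (fun p : E × (Fin j → E) => iterDirDeriv f j p.2 p.1) (U ×ˢ Set.univ) := by
  induction n generalizing j with
  | zero => exact (hf j).2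
  | succ n ih =>
    have hU' : IsOpen ((U ×ˢ Set.univ) ×ˢ Set.univ :
        Set ((E × (Fin j → E)) × (E × (Fin j → E)))) :=
      (hU.prod isOpen_univ).prod isOpen_univ
    have hd := fun (p : E × (Fin j → E)) (hp : p ∈ U ×ˢ Set.univ) (q : E × (Fin j → E)) =>
      hasDirDeriv_iterDirDeriv_prod hf hU p.2 q.2 hp.1 q.1
    refine ⟨(hf j).2, fun p hp q => .of_exists ⟨_, hd p hp q⟩, ?_⟩
    let L : ((E × (Fin j → E)) × (E × (Fin j → E))) →L[ℝ] E × (Fin (j + 1) → E) :=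
      { toFun := fun p => (p.1.1, Fin.snoc p.1.2 p.2.1)
        map_add' := fun p q => by
          refine Prod.ext rfl (funext fun i => ?_)
          refine Fin.lastCases ?_ (fun i => ?_) i <;> simp
        map_smul' := fun c p => by
          refine Prod.ext rfl (funext fun i => ?_)
          refine Fin.lastCases ?_ (fun i => ?_) i <;> simp
        cont := continuous_fst.fst.prodMk
          (Continuous.finSnoc (A := fun _ => E) continuous_fst.snd continuous_snd.fst) }
    let K (i : Fin j) : ((E × (Fin j → E)) × (E × (Fin j → E))) →L[ℝ] E × (Fin j → E) :=
      { toFun := fun p => (p.1.1, Function.update p.1.2 i (p.2.2 i))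
        map_add' := fun p q => by
          refine Prod.ext rfl (funext fun m => ?_)
          simp only [Function.update_apply, Prod.fst_add, Prod.snd_add, Pi.add_apply]
          split_ifs <;> rfl
        map_smul' := fun c p => by
          refine Prod.ext rfl (funext fun m => ?_)
          simp only [Function.update_apply, Prod.smul_fst, Prod.smul_snd, Pi.smul_apply,
            RingHom.id_apply]
          split_ifs <;> rfl
        cont := by
          refine Continuous.prodMk (by fun_prop) ?_
          exact continuous_fst.snd.update i ((continuous_apply i).comp continuous_snd.snd) }
    refine IsCn.congr hU' (IsCn.add hU' (((ih (j + 1)).comp_clm L).mono fun p hp => ⟨hp.1.1, trivial⟩)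
      (IsCn.sum Finset.univ hU' fun i _ =>
        ((ih j).comp_clm (K i)).mono fun p hp => ⟨hp.1.1, trivial⟩)) fun p hp => ?_
    exact (hd p.1 hp.1 p.2).dirDeriv_eq.symm

theorem smoothOn_iff (hU : IsOpen U) : SmoothOn f U ↔ ∀ n, IsCn n f U := by
  refine ⟨fun hf n => ?_, SmoothOn.of_isCn hU⟩
  exact ((hf.isCn_iterDirDeriv hU n 0).comp_clm
    (ContinuousLinearMap.inl ℝ E (Fin 0 → E))).mono fun x hx => ⟨hx, trivial⟩

end SmoothOn

/-! ### Smooth maps and vector fields in compatible charts -/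

section Charts

variable {E : Type u} [AddCommGroup E] [Module ℝ E] [TopologicalSpace E]
  [IsTopologicalAddGroup E] [ContinuousSMul ℝ E] [LocallyConvexSpace ℝ E] [T2Space E]
  {F : Type v} [AddCommGroup F] [Module ℝ F] [TopologicalSpace F]
  [IsTopologicalAddGroup F] [ContinuousSMul ℝ F] [LocallyConvexSpace ℝ F] [T2Space F]

theorem dirDeriv_zero (f : E → F) (x : E) : dirDeriv f x 0 = 0 :=
  HasDirDeriv.dirDeriv_eq (by simp [HasDirDeriv])

theorem SmoothOn.hasDirDeriv {f : E → F} {U : Set E} (hf : SmoothOn f U) {x : E} (hx : x ∈ U)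
    (h : E) : HasDirDeriv f x h (dirDeriv f x h) :=
  .of_exists ((hf 0).1 Fin.elim0 x hx h)

theorem SmoothOn.dirDeriv_comp {X : Type*} [AddCommGroup X] [Module ℝ X] [TopologicalSpace X]
    {g : E → F} {f : X → E} {U : Set X} {V : Set E} {x : X}
    (hV : IsOpen V) (hg : SmoothOn g V) (hf : SmoothOn f U) (hx : x ∈ U) (hfx : f x ∈ V) (h : X) :
    dirDeriv (fun y => g (f y)) x h = dirDeriv g (f x) (dirDeriv f x h) := by
  have hg1 := (smoothOn_iff hV).1 hg 1
  have hfd : HasDirDeriv f x h (dirDeriv f x h) := .of_exists ((hf 0).1 Fin.elim0 x hx h)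
  exact (hfd.comp (hV.mem_nhds hfx) hg1.2.1 (hg1.2.2.continuousOn.continuousAt
    ((hV.prod isOpen_univ).mem_nhds ⟨hfx, trivial⟩))).dirDeriv_eq

theorem SmoothOn.congr {g g' : E → F} {U : Set E} (hg : SmoothOn g U) (hU : IsOpen U)
    (h : Set.EqOn g g' U) : SmoothOn g' U :=
  (smoothOn_iff hU).2 fun n => ((smoothOn_iff hU).1 hg n).congr hU h

theorem SmoothOn.of_subtypeVal {S : Submodule ℝ F} (hS : IsClosed (S : Set F))
    {g : E → S} {U : Set E} (hU : IsOpen U) (hg : SmoothOn (fun x => (g x : F)) U) :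
    SmoothOn g U :=
  (smoothOn_iff hU).2 fun n => ((smoothOn_iff hU).1 hg n).of_subtypeVal hS hU

variable {M : Type w} [TopologicalSpace M] [ChartedSpace E M]

theorem isOpen_target_inter_preimage (φ : OpenPartialHomeomorph M E) {W : Set M} (hW : IsOpen W) :
    IsOpen (φ.target ∩ φ.symm ⁻¹' W) :=
  φ.isOpen_inter_preimage_symm hW

/-- A map which is smooth in the charts of the atlas is smooth in every compatible chart. -/
theorem IsChart.smoothOn_comp_symm {φ : OpenPartialHomeomorph M E} (hφ : IsChart E φ)
    {g : M → F} {W : Set M} (hW : IsOpen W)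
    (hg : ∀ e ∈ atlas E M, SmoothOn (fun y => g (e.symm y)) (e.target ∩ e.symm ⁻¹' W)) :
    SmoothOn (fun y => g (φ.symm y)) (φ.target ∩ φ.symm ⁻¹' W) := by
  refine (smoothOn_iff (isOpen_target_inter_preimage φ hW)).2 fun n => .of_locally ?_
  rintro y ⟨hy, hyW⟩
  let c := chartAt E (φ.symm y)
  have hc : c ∈ atlas E M := chart_mem_atlas E _
  have hV := isOpen_target_inter_preimage φ (hW.inter c.open_source)
  refine ⟨_, hV, ⟨hy, hyW, mem_chart_source E _⟩, ?_⟩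
  have h1 := (smoothOn_iff (isOpen_target_inter_preimage c hW)).1 (hg c hc) n
  have h2 := (smoothOn_iff (φ.symm.trans c).open_source).1 (hφ c hc).2 n
  refine (h1.comp hV (isOpen_target_inter_preimage c hW)
    (h2.mono fun z hz => ⟨hz.1, hz.2.2⟩) fun z hz => ⟨c.map_source hz.2.2, ?_⟩).congr hV
    fun z hz => ?_
  · simpa [c.left_inv hz.2.2] using hz.2.1
  · simp [c.left_inv hz.2.2]

/-- The derivative of a map in one chart in terms of its derivative in another chart. -/
theorem dirDeriv_comp_symm {φ e : OpenPartialHomeomorph M E} {g : M → F} {U : Set E} {p : M}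
    (hpφ : p ∈ φ.source) (hpe : p ∈ e.source)
    (he : SmoothOn (fun y => e (φ.symm y)) (φ.symm.trans e).source)
    (hU : IsOpen U) (hpU : e p ∈ U) (hg : SmoothOn (fun y => g (e.symm y)) U) (h : E) :
    dirDeriv (fun y => g (φ.symm y)) (φ p) h =
      dirDeriv (fun y => g (e.symm y)) (e p) (dirDeriv (fun y => e (φ.symm y)) (φ p) h) := by
  have hp : φ p ∈ (φ.symm.trans e).source := by
    simp [hpφ, hpe, φ.map_source hpφ]
  have h1 := SmoothOn.dirDeriv_comp hU hg he hp (by simpa [φ.left_inv hpφ] using hpU) h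
  simp only [φ.left_inv hpφ] at h1
  rw [← h1]
  refine dirDeriv_congr ?_ h
  filter_upwards [(φ.symm.trans e).open_source.mem_nhds hp] with y hy
  exact congrArg g (e.left_inv hy.2).symm

/-- The representation of a smooth vector field in a compatible chart is smooth. -/
theorem VectorField.smoothOn_of_isChart [IsSmoothManifold E M] (X : VectorField E M)
    {φ : OpenPartialHomeomorph M E} (hφ : IsChart E φ) :
    SmoothOn (fun y : E => (tangentMap E E (fun p => φ p) (φ.symm y) (X (φ.symm y)) : E))
      φ.target := by
  refine (smoothOn_iff φ.open_target).2 fun n => .of_locally fun y₀ hy₀ => ?_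
  let e := chartAt E (φ.symm y₀)
  have he : e ∈ atlas E M := chart_mem_atlas E _
  refine ⟨_, (φ.symm.trans e).open_source, ⟨hy₀, mem_chart_source E _⟩, ?_⟩
  have h1 := (smoothOn_iff (φ.symm.trans e).open_source).1 (hφ e he).2 n
  have h2 := ((smoothOn_iff (e.symm.trans φ).open_source).1 (hφ e he).1 (n + 1)).2.2
  have h3 := (smoothOn_iff e.open_target).1 (X.smooth e he) n
  have h4 := h3.comp (φ.symm.trans e).open_source e.open_target h1
    fun y hy => e.map_source hy.2
  refine (h2.comp (φ.symm.trans e).open_source ((e.symm.trans φ).open_source.prod isOpen_univ)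
    (h1.prodMk (φ.symm.trans e).open_source h4) fun y hy => ⟨⟨e.map_source hy.2, ?_⟩, trivial⟩).congr
    (φ.symm.trans e).open_source fun y hy => ?_
  · have hye : φ.symm y ∈ e.source := hy.2
    simpa [e.left_inv hye] using φ.map_target hy.1
  · have hye : φ.symm y ∈ e.source := hy.2
    have hc := chart_mem_atlas E (φ.symm y)
    have hX : (X (e.symm (e (φ.symm y))) : E) = X (φ.symm y) :=
      congrArg (fun p => (X p : E)) (e.left_inv hye)
    simp only [tangentMap, chartAt_self_eq, OpenPartialHomeomorph.refl_apply, e.left_inv hye]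
    rw [hX]
    refine (dirDeriv_comp_symm (g := φ) (mem_chart_source E _) hye
      (IsSmoothManifold.smooth_chart_change _ hc e he) (e.symm.trans φ).open_source
      ⟨e.map_source hye, ?_⟩ (hφ e he).1 _).symm
    simpa [e.left_inv hye] using φ.map_target hy.1

end Charts

/-! ### Submanifolds -/

section Submanifold

variable {E : Type u} [AddCommGroup E] [Module ℝ E] [TopologicalSpace E]
  {M : Type w} [TopologicalSpace M]

section RestrictChart

variable {S : Submodule ℝ E} {N : Set M} {φ : OpenPartialHomeomorph M E}
  (hφ : φ '' (φ.source ∩ N) = φ.target ∩ S) (n₀ : N)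

theorem coe_restrictChart {x : N} (hx : (x : M) ∈ φ.source) :
    (restrictChart S N φ hφ n₀ x : E) = φ x := by
  simp [restrictChart, hx]

theorem coe_restrictChart_symm {y : S} (hy : (y : E) ∈ φ.target) :
    ((restrictChart S N φ hφ n₀).symm y : M) = φ.symm y :=
  congrArg Subtype.val (dif_pos hy)

variable {F : Type v} [AddCommGroup F] [Module ℝ F] [TopologicalSpace F]

theorem dirDeriv_comp_restrictChart_symm [IsTopologicalAddGroup E] [ContinuousSMul ℝ E]
    (g : M → F) {n : N} (hn : (n : M) ∈ φ.source) (v : S) :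
    dirDeriv (fun y : S => g ((restrictChart S N φ hφ n₀).symm y)) (restrictChart S N φ hφ n₀ n) v =
      dirDeriv (fun y => g (φ.symm y)) (φ n) v := by
  rw [← coe_restrictChart hφ n₀ hn]
  refine Eq.trans ?_ (dirDeriv_comp_clm (fun y => g (φ.symm y)) S.subtypeL _ v)
  refine dirDeriv_congr ?_ v
  have ho : restrictChart S N φ hφ n₀ n ∈ (restrictChart S N φ hφ n₀).target :=
    (restrictChart S N φ hφ n₀).map_source hn
  filter_upwards [(restrictChart S N φ hφ n₀).open_target.mem_nhds ho] with y hy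
  rw [coe_restrictChart_symm hφ n₀ hy]
  rfl

end RestrictChart

variable [ChartedSpace E M] (N : Submanifold E M)

namespace Submanifold

/-- The preferred charts of a submanifold are restrictions of adapted charts. -/
theorem exists_chartAt_eq (n : N.carrier) : ∃ (φ : OpenPartialHomeomorph M E)
    (hφ : φ '' (φ.source ∩ N.carrier) = φ.target ∩ N.model), (n : M) ∈ φ.source ∧ IsChart E φ ∧
      chartAt N.model n = restrictChart N.model N.carrier φ hφ n :=
  ⟨_, (N.exists_slice n n.2).choose_spec.2.2, (N.exists_slice n n.2).choose_spec.1,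
    (N.exists_slice n n.2).choose_spec.2.1, rfl⟩

variable [IsTopologicalAddGroup E] [ContinuousSMul ℝ E] [LocallyConvexSpace ℝ E] [T2Space E]
  {F : Type v} [AddCommGroup F] [Module ℝ F] [TopologicalSpace F]
  [IsTopologicalAddGroup F] [ContinuousSMul ℝ F] [LocallyConvexSpace ℝ F] [T2Space F]

/-- The chain rule for the composition of a map with the inclusion of a submanifold. -/
theorem dirDeriv_comp_chartAt_symm (n : N.carrier) {g : M → F} {U : Set E}
    (hU : IsOpen U) (hnU : chartAt E (n : M) n ∈ U)
    (hg : SmoothOn (fun y => g ((chartAt E (n : M)).symm y)) U) (v : TSpace N.model n) :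
    dirDeriv (fun y => g ((chartAt N.model n).symm y)) (chartAt N.model n n) v =
      dirDeriv (fun y => g ((chartAt E (n : M)).symm y)) (chartAt E (n : M) n)
        (tangentMap N.model E N.incl n v) := by
  obtain ⟨φ, hφ, hn, hc, h⟩ := N.exists_chartAt_eq n
  have h1 : tangentMap N.model E N.incl n v =
      dirDeriv (fun y => chartAt E (n : M) (φ.symm y)) (φ n) v := by
    unfold tangentMap
    rw [h]
    exact dirDeriv_comp_restrictChart_symm hφ n (chartAt E (n : M)) hn v
  rw [h1, h, dirDeriv_comp_restrictChart_symm hφ n g hn v]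
  exact dirDeriv_comp_symm hn (mem_chart_source E _) (hc _ (chart_mem_atlas E _)).2 hU hnU hg _

theorem tangentMap_comp_incl {f : M → ℝ} (hf : IsSmooth E ℝ f) (n : N.carrier)
    (v : TSpace N.model n) :
    tangentMap N.model ℝ (f ∘ N.incl) n v =
      tangentMap E ℝ f n (tangentMap N.model E N.incl n v) := by
  have h := hf.2 (chartAt E (n : M)) (chart_mem_atlas E _) (.refl ℝ) rfl
  exact N.dirDeriv_comp_chartAt_symm n (g := f)
    (isOpen_target_inter_preimage _ (isOpen_univ.preimage hf.1))
    ⟨mem_chart_target E _, trivial⟩ h v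

theorem dirDeriv_isChart_comp_chartAt_symm {φ : OpenPartialHomeomorph M E} (hφ : IsChart E φ)
    (n : N.carrier) (hn : (n : M) ∈ φ.source) (v : TSpace N.model n) :
    dirDeriv (fun y => φ ((chartAt N.model n).symm y)) (chartAt N.model n n) v =
      tangentMap E E (fun p => φ p) n (tangentMap N.model E N.incl n v) := by
  have h := (hφ (chartAt E (n : M)) (chart_mem_atlas E _)).1
  exact N.dirDeriv_comp_chartAt_symm n (g := φ)
    ((chartAt E (n : M)).symm.trans φ).open_source
    ⟨mem_chart_target E _, by simpa using hn⟩ h v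

/-- An adapted chart of `M` after the inclusion is the inclusion of the model spaces in the
corresponding chart of `N`, hence has injective differential. -/
theorem tangentMap_incl_injective (n : N.carrier) {v : TSpace N.model n}
    (hv : tangentMap N.model E N.incl n v = (0 : E)) : v = 0 := by
  obtain ⟨φ, hφ, hn, hc, h⟩ := N.exists_chartAt_eq n
  have h1 := N.dirDeriv_isChart_comp_chartAt_symm hc n hn v
  rw [hv, h] at h1
  unfold tangentMap at h1
  rw [dirDeriv_zero] at h1
  have ho : restrictChart N.model N.carrier φ hφ n n ∈
    (restrictChart N.model N.carrier φ hφ n).target :=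
    (restrictChart N.model N.carrier φ hφ n).map_source hn
  have h2 : HasDirDeriv (fun y : N.model => (y : E))
      (restrictChart N.model N.carrier φ hφ n n) v (v : E) := by
    refine Tendsto.congr' ?_ tendsto_const_nhds
    filter_upwards [self_mem_nhdsWithin] with t ht
    have ht : t ≠ 0 := ht
    simp [inv_smul_smul₀ ht]
  have h3 := h2.congr (g := fun y => φ ((restrictChart N.model N.carrier φ hφ n).symm y)) (by
    filter_upwards [(restrictChart N.model N.carrier φ hφ n).open_target.mem_nhds ho] with y hy
    rw [coe_restrictChart_symm hφ n hy, φ.right_inv hy])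
  rw [h3.dirDeriv_eq] at h1
  exact Subtype.ext h1

theorem smoothOn_comp_subtype {g : E → F} {U : Set E} (hU : IsOpen U) (hg : SmoothOn g U) :
    SmoothOn (fun y : N.model => g y) (Subtype.val ⁻¹' U) :=
  (smoothOn_iff (hU.preimage continuous_subtype_val)).2 fun n =>
    ((smoothOn_iff hU).1 hg n).comp_clm N.model.subtypeL

instance isSmoothManifold [IsSmoothManifold E M] : IsSmoothManifold N.model N.carrier where
  smooth_chart_change := by
    rintro _ ⟨φ, hc, hφ, n, rfl⟩ _ ⟨φ', hc', hφ', n', rfl⟩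
    refine SmoothOn.of_subtypeVal N.isClosed_model (OpenPartialHomeomorph.open_source _) ?_
    have h1 := N.smoothOn_comp_subtype (isOpen_target_inter_preimage φ φ'.open_source)
      (hc.smoothOn_comp_symm (g := φ') φ'.open_source fun e he => (hc' e he).1)
    have hs : ((restrictChart N.model N.carrier φ hφ n).symm.trans
        (restrictChart N.model N.carrier φ' hφ' n')).source =
        Subtype.val ⁻¹' (φ.target ∩ φ.symm ⁻¹' φ'.source) := by
      ext y
      refine and_congr_right fun hy => ?_
      change ((restrictChart N.model N.carrier φ hφ n).symm y : M) ∈ φ'.source ↔ _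
      rw [coe_restrictChart_symm hφ n hy]
      rfl
    rw [hs]
    refine h1.congr ((isOpen_target_inter_preimage φ φ'.open_source).preimage
      continuous_subtype_val) fun y hy => ?_
    have hy1 := coe_restrictChart_symm hφ n hy.1
    rw [coe_restrictChart hφ' n' (by rw [hy1]; exact hy.2), hy1]

/-- Maps on `M` restrict to smooth maps on a submanifold. -/
theorem smoothOn_comp_symm {g : M → F} {W : Set M} (hW : IsOpen W)
    (hg : ∀ e ∈ atlas E M, SmoothOn (fun y => g (e.symm y)) (e.target ∩ e.symm ⁻¹' W))
    {e : OpenPartialHomeomorph N.carrier N.model} (he : e ∈ atlas N.model N.carrier) :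
    SmoothOn (fun y => g (e.symm y)) (e.target ∩ e.symm ⁻¹' (N.incl ⁻¹' W)) := by
  obtain ⟨φ, hc, hφ, n, rfl⟩ := he
  have h1 := N.smoothOn_comp_subtype (isOpen_target_inter_preimage φ hW)
    (hc.smoothOn_comp_symm hW hg)
  have hs : (restrictChart N.model N.carrier φ hφ n).target ∩
      (restrictChart N.model N.carrier φ hφ n).symm ⁻¹' (N.incl ⁻¹' W) =
      Subtype.val ⁻¹' (φ.target ∩ φ.symm ⁻¹' W) := by
    ext y
    refine and_congr_right fun hy => ?_
    change ((restrictChart N.model N.carrier φ hφ n).symm y : M) ∈ W ↔ _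
    rw [coe_restrictChart_symm hφ n hy]
    rfl
  rw [hs]
  refine h1.congr ((isOpen_target_inter_preimage φ hW).preimage
    continuous_subtype_val) fun y hy => ?_
  rw [coe_restrictChart_symm hφ n hy.1]

theorem isSmooth_incl [IsSmoothManifold E M] : IsSmooth N.model E N.incl :=
  ⟨continuous_subtype_val, fun _ he e' he' => N.smoothOn_comp_symm e'.open_source
    (fun e he => IsSmoothManifold.smooth_chart_change e he e' he') he⟩

theorem isSmooth_comp_incl {f : M → ℝ} (hf : IsSmooth E ℝ f) : IsSmooth N.model ℝ (f ∘ N.incl) := by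
  refine ⟨hf.1.comp continuous_subtype_val, fun e he e' he' => ?_⟩
  exact N.smoothOn_comp_symm (g := fun p => e' (f p)) (e'.open_source.preimage hf.1)
    (fun e he => hf.2 e he e' he') he

/-- The differential of a chart of `N` is the restriction of that of the adapted chart of `M`. -/
theorem coe_tangentMap_restrictChart [IsSmoothManifold E M]
    {φ : OpenPartialHomeomorph M E} (hc : IsChart E φ)
    (hφ : φ '' (φ.source ∩ N.carrier) = φ.target ∩ N.model) (n₀ n : N.carrier)
    (hn : (n : M) ∈ φ.source) (v : TSpace N.model n) :
    ((tangentMap N.model N.model (fun p => restrictChart N.model N.carrier φ hφ n₀ p) n v :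
      N.model) : E) = tangentMap E E (fun p => φ p) n (tangentMap N.model E N.incl n v) := by
  rw [← N.dirDeriv_isChart_comp_chartAt_symm hc n hn v]
  have hs : chartAt N.model n n ∈ ((chartAt N.model n).symm.trans
      (restrictChart N.model N.carrier φ hφ n₀)).source :=
    ⟨mem_chart_target _ _, by
      rw [Set.mem_preimage]
      exact ((chartAt N.model n).left_inv (mem_chart_source _ _)).symm ▸ hn⟩
  have h1 := (IsSmoothManifold.smooth_chart_change (chartAt N.model n) (chart_mem_atlas _ _)
    (restrictChart N.model N.carrier φ hφ n₀) ⟨φ, hc, hφ, n₀, rfl⟩).hasDirDeriv hs v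
  refine ((h1.clm_comp N.model.subtypeL).congr ?_).dirDeriv_eq.symm
  filter_upwards [(OpenPartialHomeomorph.open_source _).mem_nhds hs] with y hy
  exact coe_restrictChart hφ n₀ hy.2

/-- A vector field on `M` that is tangential to a submanifold restricts to it. -/
theorem exists_restrict_vectorField [IsSmoothManifold E M] (X : VectorField E M)
    (hX : ∀ n : N.carrier, N.IsTangent n (X n)) :
    ∃ Y : VectorField N.model N.carrier,
      ∀ n : N.carrier, tangentMap N.model E N.incl n (Y n) = X n := by
  choose Y hY using hX
  refine ⟨⟨Y, ?_⟩, hY⟩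
  rintro _ ⟨φ, hc, hφ, n₀, rfl⟩
  refine SmoothOn.of_subtypeVal N.isClosed_model (OpenPartialHomeomorph.open_target _) ?_
  refine (N.smoothOn_comp_subtype φ.open_target (X.smoothOn_of_isChart hc)).congr
    (φ.open_target.preimage continuous_subtype_val) fun y hy => ?_
  have hy1 := coe_restrictChart_symm hφ n₀ hy
  rw [N.coe_tangentMap_restrictChart hc hφ n₀ _ ((restrictChart _ _ φ hφ n₀).map_target hy), hY,
    hy1]

end Submanifold

end Submanifold

/-! ### Restriction of weak Poisson structures -/

section Poisson

variable {E : Type*} [AddCommGroup E] [Module ℝ E] [TopologicalSpace E]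
  {M : Type*} [TopologicalSpace M] [ChartedSpace E M]
  (P : WeakPoissonStructure E M) (N : Submanifold E M)

/-- The restriction of the functions in the algebra of a weak Poisson structure to a
submanifold. -/
def restrictAlgHom : P.algebra →ₐ[ℝ] (N.carrier → ℝ) :=
  (AlgHom.pi fun n => Pi.evalAlgHom ℝ (fun _ : M => ℝ) (N.incl n)).comp P.algebra.val

theorem rangeRestrict_restrictAlgHom_eq_iff {F G : P.algebra} :
    (restrictAlgHom P N).rangeRestrict F = (restrictAlgHom P N).rangeRestrict G ↔
      F - G ∈ vanishingIdeal P N.carrier := by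
  rw [Subtype.ext_iff, funext_iff]
  constructor
  · intro h n hn
    exact sub_eq_zero.2 (h ⟨n, hn⟩)
  · intro h n
    exact sub_eq_zero.1 (h n n.2)

theorem WeakPoissonStructure.deriv_hamiltonian (F G : P.algebra) (p : M) :
    (P.bracket F G : M → ℝ) p = tangentMap E ℝ (F : M → ℝ) p (P.hamiltonian G p) :=
  (congrFun ((P.exists_hamiltonian G).choose_spec F) p).symm

variable [IsTopologicalAddGroup E] [ContinuousSMul ℝ E] [LocallyConvexSpace ℝ E] [T2Space E]
  {P N}

/-- If `F` vanishes on `N`, then so do its derivatives in directions tangential to `N`. -/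
theorem bracket_mem_vanishingIdeal
    (hN : ∀ (F : P.algebra) (n : N.carrier), N.IsTangent n (P.hamiltonian F n))
    {F : P.algebra} (hF : F ∈ vanishingIdeal P N.carrier) (G : P.algebra) :
    P.bracket F G ∈ vanishingIdeal P N.carrier := by
  intro n hn
  obtain ⟨w, hw⟩ := hN G ⟨n, hn⟩
  have h0 : (F : M → ℝ) ∘ N.incl = fun _ => 0 := funext fun m => hF m m.2
  rw [P.deriv_hamiltonian]
  change tangentMap E ℝ (F : M → ℝ) (⟨n, hn⟩ : N.carrier) _ = (0 : ℝ)
  rw [← hw, ← N.tangentMap_comp_incl (P.smooth F F.2), h0]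
  exact HasDirDeriv.dirDeriv_eq (by simp [HasDirDeriv])

theorem bracket_sub_bracket_mem_vanishingIdeal
    (hN : ∀ (F : P.algebra) (n : N.carrier), N.IsTangent n (P.hamiltonian F n))
    {F F' G G' : P.algebra} (hF : F - F' ∈ vanishingIdeal P N.carrier)
    (hG : G - G' ∈ vanishingIdeal P N.carrier) :
    P.bracket F G - P.bracket F' G' ∈ vanishingIdeal P N.carrier := by
  have h1 := bracket_mem_vanishingIdeal hN hF G
  have h2 := bracket_mem_vanishingIdeal hN hG F'
  have h3 : P.bracket F G - P.bracket F' G' =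
      P.bracket (F - F') G - P.bracket (G - G') F' := by
    rw [P.skew (G - G') F']
    simp
  rw [h3]
  exact sub_mem h1 h2

variable (P N)

/-- The bracket on the restrictions of functions to a submanifold. It is computed with the help of
a linear section of the restriction map; if the Hamiltonian vector fields are tangential to the
submanifold, it does not depend on this choice. -/
noncomputable def restrictBracket : (restrictAlgHom P N).range →ₗ[ℝ]
    (restrictAlgHom P N).range →ₗ[ℝ] (restrictAlgHom P N).range :=
  let s := ((restrictAlgHom P N).rangeRestrict.toLinearMap.exists_rightInverse_of_surjective
    (LinearMap.range_eq_top.2 (restrictAlgHom P N).rangeRestrict_surjective)).choose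
  (P.bracket.compl₁₂ s s).compr₂ (restrictAlgHom P N).rangeRestrict.toLinearMap

variable {P N}

theorem restrictBracket_apply
    (hN : ∀ (F : P.algebra) (n : N.carrier), N.IsTangent n (P.hamiltonian F n))
    (F G : P.algebra) :
    restrictBracket P N ((restrictAlgHom P N).rangeRestrict F)
      ((restrictAlgHom P N).rangeRestrict G) =
        (restrictAlgHom P N).rangeRestrict (P.bracket F G) := by
  have hs := ((restrictAlgHom P N).rangeRestrict.toLinearMap.exists_rightInverse_of_surjective
    (LinearMap.range_eq_top.2 (restrictAlgHom P N).rangeRestrict_surjective)).choose_spec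
  have hs' := fun F : P.algebra => (rangeRestrict_restrictAlgHom_eq_iff P N).1
    (LinearMap.congr_fun hs ((restrictAlgHom P N).rangeRestrict F))
  exact (rangeRestrict_restrictAlgHom_eq_iff P N).2
    (bracket_sub_bracket_mem_vanishingIdeal hN (hs' F) (hs' G))

variable [IsSmoothManifold E M]

/-- The weak Poisson structure induced on a submanifold to which all Hamiltonian vector fields are
tangential. -/
noncomputable def WeakPoissonStructure.restrict
    (hN : ∀ (F : P.algebra) (n : N.carrier), N.IsTangent n (P.hamiltonian F n)) :
    WeakPoissonStructure N.model N.carrier where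
  algebra := (restrictAlgHom P N).range
  smooth := by
    rintro _ ⟨F, rfl⟩
    exact N.isSmooth_comp_incl (P.smooth F F.2)
  bracket := restrictBracket P N
  skew F G := by
    obtain ⟨F, rfl⟩ := (restrictAlgHom P N).rangeRestrict_surjective F
    obtain ⟨G, rfl⟩ := (restrictAlgHom P N).rangeRestrict_surjective G
    rw [restrictBracket_apply hN, restrictBracket_apply hN, P.skew, map_neg]
  jacobi F G H := by
    obtain ⟨F, rfl⟩ := (restrictAlgHom P N).rangeRestrict_surjective F
    obtain ⟨G, rfl⟩ := (restrictAlgHom P N).rangeRestrict_surjective G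
    obtain ⟨H, rfl⟩ := (restrictAlgHom P N).rangeRestrict_surjective H
    simp only [restrictBracket_apply hN]
    rw [P.jacobi, map_add]
  leibniz F G H := by
    obtain ⟨F, rfl⟩ := (restrictAlgHom P N).rangeRestrict_surjective F
    obtain ⟨G, rfl⟩ := (restrictAlgHom P N).rangeRestrict_surjective G
    obtain ⟨H, rfl⟩ := (restrictAlgHom P N).rangeRestrict_surjective H
    rw [← map_mul]
    simp only [restrictBracket_apply hN]
    rw [P.leibniz, map_add, map_mul, map_mul]
  separating n v hv := by
    refine N.tangentMap_incl_injective n (P.separating n _ fun F hF => ?_)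
    rw [← N.tangentMap_comp_incl (P.smooth F hF)]
    exact hv _ ⟨⟨F, hF⟩, rfl⟩
  exists_hamiltonian H := by
    obtain ⟨H, rfl⟩ := (restrictAlgHom P N).rangeRestrict_surjective H
    obtain ⟨Y, hY⟩ := N.exists_restrict_vectorField (P.hamiltonian H) (hN H)
    refine ⟨Y, fun F => ?_⟩
    obtain ⟨F, rfl⟩ := (restrictAlgHom P N).rangeRestrict_surjective F
    rw [restrictBracket_apply hN]
    funext n
    refine (N.tangentMap_comp_incl (P.smooth F F.2) n (Y n)).trans ?_
    rw [hY]
    exact (P.deriv_hamiltonian F H n).symm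

end Poisson

end LC

theorem proposition1p3
    {E : Type*} [AddCommGroup E] [Module ℝ E] [TopologicalSpace E] [IsTopologicalAddGroup E]
    [ContinuousSMul ℝ E] [LocallyConvexSpace ℝ E] [T2Space E]
    {M : Type*} [TopologicalSpace M] [ChartedSpace E M] [LC.IsSmoothManifold E M]
    (P : LC.WeakPoissonStructure E M) (N : LC.Submanifold E M)
    (hN : ∀ (F : P.algebra) (n : N.carrier), N.IsTangent n (P.hamiltonian F n)) :
    -- the functions vanishing on `N` form a Poisson ideal
    (∀ F ∈ LC.vanishingIdeal P N.carrier, ∀ G : P.algebra,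
      P.bracket F G ∈ LC.vanishingIdeal P N.carrier) ∧
    -- with the charts induced from `M`, the set `N` is a manifold
    LC.IsSmoothManifold N.model N.carrier ∧
    -- the quotient by this ideal, identified with an algebra of functions on `N` through the
    -- restriction of functions, is with the induced bracket a weak Poisson structure on `N`
    ∃ (Q : LC.WeakPoissonStructure N.model N.carrier)
      (Φ : (P.algebra ⧸ LC.vanishingIdeal P N.carrier) ≃ₐ[ℝ] Q.algebra),
      (∀ F : P.algebra, (Φ (Ideal.Quotient.mk _ F) : N.carrier → ℝ) = (F : M → ℝ) ∘ N.incl) ∧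
      (∀ F G : P.algebra, Q.bracket (Φ (Ideal.Quotient.mk _ F)) (Φ (Ideal.Quotient.mk _ G)) =
        Φ (Ideal.Quotient.mk _ (P.bracket F G))) ∧
      -- and the inclusion is a Poisson map
      LC.IsPoissonMap Q P N.incl := by
  have hker : LC.vanishingIdeal P N.carrier =
      RingHom.ker (LC.restrictAlgHom P N).rangeRestrict := by
    ext F
    rw [RingHom.mem_ker, ← map_zero (LC.restrictAlgHom P N).rangeRestrict,
      LC.rangeRestrict_restrictAlgHom_eq_iff, sub_zero]
  refine ⟨fun F hF G => LC.bracket_mem_vanishingIdeal hN hF G, inferInstance,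
    LC.WeakPoissonStructure.restrict hN, (Ideal.quotientEquivAlgOfEq ℝ hker).trans
      (Ideal.quotientKerAlgEquivOfSurjective (LC.restrictAlgHom P N).rangeRestrict_surjective),
    fun F => rfl, fun F G => LC.restrictBracket_apply hN F G, N.isSmooth_incl,
    fun F => ⟨F, rfl⟩, fun F G => ?_⟩
  exact congrArg Subtype.val (LC.restrictBracket_apply hN F G).symm
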